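/- Let $\mathbb{F}_q$ be the field with $q$ elements, $q$ prime. A code $\mathcal C\subseteq\mathbb F_q^n$ is called $(\alpha,\ell,L)$-list-recoverable from erasures if $|\mathcal C\cap(T_1\times\cdots\times T_n)|\le L$ for all $T_1,\dots,T_n\subseteq\mathbb F_q$ such that $|T_i|\le \ell$ for at least $(1-\alpha)n$ of the indices $i$ and $T_i=\mathbb F_q$ for the remaining ones. A random linear code of block length $n$ and rate $R$ is $\{x\in\mathbb F_q^n: Hx=0\}$ for a uniformly random matrix $H\in\mathbb F_q^{\lceil(1-R)n\rceil\times n}$. **Theorem.** For every prime $q$, integer $2\le \ell\le q-1$ and $\alpha\in(0,1)$ there is a constant $C_{q,\ell,\alpha}>0$ such that for all $\varepsilon\in(0,1)$ and all $n\in\mathbb N$ the following holds. Put $L=C_{q,\ell,\alpha}/\varepsilon$. If $n\ge L$, then a random linear code $\mathcal C\subseteq\mathbb F_q^n$ of rate $$R=1-\alpha-(1-\alpha)\log_q\ell-\varepsilon$$ is, with probability at least $1-q^{-n}$, $(\alpha,\ell,L)$-list-recoverable from erasures. Moreover, the constants $C_{q,\ell,\alpha}$ can be chosen so that for every $\alpha_0<1$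 there is a constant $K>0$, depending only on $\alpha_0$, such that, with $$C^{(0)}_{q,\ell,\alpha}=q^{K\log_2 q\cdot((1-\alpha)\ell+1)},$$ the following holds for all primes $q$, integers $2\le\ell\le q-1$ and $\alpha\in(0,\alpha_0]$: - if $\ell\le\frac23 q$, then $C_{q,\ell,\alpha}\le C^{(0)}_{q,\ell,\alpha}$; - if $\ell=(1-\gamma)q$ with $\gamma\in(0,1/3)$, then $C_{q,\ell,\alpha}\le\bigl(C^{(0)}_{q,\ell,\alpha}\bigr)^{\frac{(1-\gamma)^2}{1-3\gamma(1-\gamma)}}$. -/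

import Mathlib

/-- A code `𝒞 ⊆ Fⁿ` is `(α, ℓ, L)`-list-recoverable from erasures: for all input lists
`T₁, …, Tₙ ⊆ F` such that `|T i| ≤ ℓ` for at least `(1 - α) n` of the indices (those in `G`) and
`T i = F` for the remaining ones, `|𝒞 ∩ (T₁ × ⋯ × Tₙ)| ≤ L`. -/
def IsListRecoverableFromErasures {F : Type*} [Fintype F] {n : ℕ}
    (𝒞 : Set (Fin n → F)) (α : ℝ) (ℓ : ℕ) (L : ℝ) : Prop :=
  ∀ (T : Fin n → Finset F) (G : Finset (Fin n)),
    (1 - α) * (n : ℝ) ≤ (G.card : ℝ) →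
    (∀ i ∈ G, (T i).card ≤ ℓ) →
    (∀ i ∉ G, T i = Finset.univ) →
    (((𝒞 ∩ {x | ∀ i, x i ∈ T i}).ncard : ℕ) : ℝ) ≤ L

/-- The random linear code over `F_q` (`q` prime) of block length `n` and rate `R`: the law of the
kernel `{x | H x = 0}` of a uniformly random matrix `H` with `(1 - R) n` rows (rounded up to an
integer) and `n` columns. -/
noncomputable def randomLinearCode (q n : ℕ) [Fact q.Prime] (R : ℝ) :
    PMF (Submodule (ZMod q) (Fin n → ZMod q)) :=
  (PMF.uniformOfFintype (Matrix (Fin ⌈(1 - R) * (n : ℝ)⌉₊) (Fin n) (ZMod q))).map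
    fun H => LinearMap.ker H.mulVecLin

/-- The rate `1 - α - (1 - α) log_q ℓ - ε`, at distance `ε` from the capacity of list recovery
from erasures. -/
noncomputable def erasureRate (q ℓ : ℕ) (α ε : ℝ) : ℝ :=
  1 - α - (1 - α) * Real.logb q ℓ - ε

/-- `q ^ (K · log q · ((1 - α) ℓ + 1))`, where `log` is the logarithm to base `2`. -/
noncomputable def erasureConst (K : ℝ) (q ℓ : ℕ) (α : ℝ) : ℝ :=
  (q : ℝ) ^ (K * Real.logb 2 q * ((1 - α) * (ℓ : ℝ) + 1))

/-! Fix input lists `T`, let `τ` be the size of their product divided by `q` to the number of rows;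
below capacity, `τ ≤ q ^ (-ε n)`. If the code meets the product in many points, either `k` of them
are independent, or they span a space of rank `r < k`. The first case has probability at most `τ ^
k`, enough once `k` is of order `m / ε`, where `m = min ℓ (q - ℓ)`.

In the second case the coefficient vectors of these points form a large subset of `F ^ r`, so they
contain a chain of `d + 1` vectors in which each but the last deviates from the last one in two
coordinates of its own (`exists_isTwoIncreasingChain`). Each deviation tests a form `a x + b y + s`
on a list `A`. On a proper list the test fails with probability at least `m / (100 ℓ)`:
Cauchy–Davenport excludes near-closure of small `A`, and direct counting treats large `A`
(`ZMod.min_mul_card_le_card_affine_notMem`). The tests decouple along the chain, so a tuple passes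
with probability at most `(q δ ^ d) ^ |G|`, where `δ = 1 - m / (100 ℓ)`.

There are at most `q ^ (2 m n)` choices of lists. As both this entropy and the gain scale with `m`,
a length `d` of order `ℓ log q / (1 - α)` survives the union bound, giving the constant `q ^ (2 d +
3)`. -/

/-! ### Affine forms in two variables on a subset of a field -/

open Finset in
/-- For a large set `A`, the form `a x + b y + s` maps many pairs of elements of `A` outside `A`. -/
theorem mul_two_mul_sub_le_card_affine_notMem {F : Type*} [Field F] [Fintype F] [DecidableEq F]
    (A : Finset F) (a b s : F) (ha : a ≠ 0) (hb : b ≠ 0) :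
    (2 * #A - Fintype.card F) * (Fintype.card F - #A) ≤
      #{p ∈ A ×ˢ A | a * p.1 + b * p.2 + s ∉ A} := by
  rw [← card_compl]
  refine mul_card_image_le_card_of_maps_to (f := fun p => a * p.1 + b * p.2 + s)
    (fun p hp => by simpa using (mem_filter.1 hp).2) _ fun z hz => ?_
  have hφ : Function.Injective fun x => (z - s - a * x) / b := by
    intro x y hxy
    have := (div_left_inj' hb).1 hxy
    exact mul_left_cancel₀ ha (by linear_combination -this)
  -- For fixed `z`, distinct `x` force distinct `y`, so at most `#Aᶜ` of the `x ∈ A` have their `y`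
  -- outside `A`.
  have h1 : #{x ∈ A | (z - s - a * x) / b ∉ A} ≤ #Aᶜ :=
    card_le_card_of_injOn _ (fun x hx => by simpa using (mem_filter.1 hx).2) hφ.injOn
  have h2 := card_filter_add_card_filter_not (s := A) fun x => (z - s - a * x) / b ∈ A
  rw [card_compl] at h1
  calc 2 * #A - Fintype.card F ≤ #{x ∈ A | (z - s - a * x) / b ∈ A} := by
        have := card_le_univ A
        omega
    _ ≤ _ := by
      refine card_le_card_of_injOn (fun x => (x, (z - s - a * x) / b)) (fun x hx => ?_)
        fun x _ y _ h => congrArg Prod.fst h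
      have hx' := mem_filter.1 hx
      have e : a * x + b * ((z - s - a * x) / b) + s = z := by field_simp; ring
      simpa [e, hx'.1, hx'.2] using hz

open Finset in
/-- If `y ↦ a x + b y + s` maps most of `A` into `A` for two values `x`, `x'`, then `x - x'` is
proportional to many differences of elements of `A`. -/
theorem card_filter_sub_eq_of_card_affine_notMem {F : Type*} [Field F] [DecidableEq F]
    (A : Finset F) (a b s : F) (ha : a ≠ 0) (hb : b ≠ 0) (x x' : F)
    (hx : 12 * #{y ∈ A | a * x + b * y + s ∉ A} < #A)
    (hx' : 12 * #{y ∈ A | a * x' + b * y + s ∉ A} < #A) :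
    5 * #A / 6 + 1 ≤ #{p ∈ A ×ˢ A | b * (p.2 - p.1) / a = x - x'} := by
  -- Both `x` and `x'` reach more than 11/12 of `A`, so they share more than 5/6 of it; each shared
  -- value `c` is attained at some `y` and `y'`, and subtracting the two equations represents `x -
  -- x'`.
  have hI : ∀ x, 12 * #{y ∈ A | a * x + b * y + s ∉ A} < #A →
      11 * #A < 12 * #{c ∈ A | (c - s - a * x) / b ∈ A} := by
    intro x h1
    have h2 := card_filter_add_card_filter_not (s := A) fun y => a * x + b * y + s ∈ A
    have h3 : #{y ∈ A | a * x + b * y + s ∈ A} ≤ #{c ∈ A | (c - s - a * x) / b ∈ A} := by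
      refine card_le_card_of_injOn (fun y => a * x + b * y + s) (fun y hy => ?_) ?_
      · have e : (a * x + b * y + s - s - a * x) / b = y := by field_simp; ring
        have hy' := mem_filter.1 hy
        simp only [coe_filter, Set.mem_ofPred_eq, e]
        exact hy'.symm
      · intro y _ z _ h
        exact mul_left_cancel₀ hb (by linear_combination h)
    omega
  have h1 := hI x hx
  have h2 := hI x' hx'
  have h3 := card_union_add_card_inter {c ∈ A | (c - s - a * x) / b ∈ A}
    {c ∈ A | (c - s - a * x') / b ∈ A}
  have h4 := card_le_card (union_subset (filter_subset (fun c => (c - s - a * x) / b ∈ A) A)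
    (filter_subset (fun c => (c - s - a * x') / b ∈ A) A))
  refine le_trans (by omega : _ ≤ #({c ∈ A | (c - s - a * x) / b ∈ A} ∩
    {c ∈ A | (c - s - a * x') / b ∈ A})) ?_
  refine card_le_card_of_injOn (fun c => ((c - s - a * x) / b, (c - s - a * x') / b))
    (fun c hc => ?_) ?_
  · have e : b * ((c - s - a * x') / b - (c - s - a * x) / b) / a = x - x' := by
      field_simp; ring
    have hc' := mem_inter.1 hc
    simp only [mem_filter] at hc'
    simp only [coe_filter, mem_product, Set.mem_ofPred_eq]
    exact ⟨⟨hc'.1.2, hc'.2.2⟩, e⟩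
  · intro c _ c' _ h
    have := (div_left_inj' hb).1 (congrArg Prod.fst h)
    linear_combination this

open Finset Pointwise in
/-- If `y ↦ a x + b y + s` maps most of `A` into `A` for all `x ∈ A'`, then `A'` has few
differences. -/
theorem card_sub_mul_le_of_card_affine_notMem {F : Type*} [Field F] [DecidableEq F]
    (A A' : Finset F) (a b s : F) (ha : a ≠ 0) (hb : b ≠ 0)
    (h : ∀ x ∈ A', 12 * #{y ∈ A | a * x + b * y + s ∉ A} < #A) :
    (5 * #A / 6 + 1) * #(A' - A') ≤ #A * #A := by
  have hfib : ∀ t ∈ A' - A', 5 * #A / 6 + 1 ≤ #{p ∈ A ×ˢ A | b * (p.2 - p.1) / a = t} := by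
    intro t ht
    obtain ⟨x, hx, x', hx', rfl⟩ := mem_sub.1 ht
    exact card_filter_sub_eq_of_card_affine_notMem A a b s ha hb x x' (h x hx) (h x' hx')
  generalize A' - A' = D at hfib ⊢
  have key := mul_card_image_le_card_of_maps_to (s := {p ∈ A ×ˢ A | b * (p.2 - p.1) / a ∈ D})
    (t := D) (f := fun p => b * (p.2 - p.1) / a) (fun p hp => (mem_filter.1 hp).2)
    (5 * #A / 6 + 1) fun t ht => by
      refine (hfib t ht).trans (card_le_card fun p hp => ?_)
      rw [mem_filter] at hp
      rw [mem_filter, mem_filter, hp.2]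
      exact ⟨⟨hp.1, ht⟩, rfl⟩
  exact key.trans ((card_filter_le _ _).trans_eq (card_product _ _))

open Finset Pointwise in
/-- For a set `A` of at most two thirds of the residues modulo `q`, the form `a x + b y + s` maps a
positive proportion of the pairs of elements of `A` outside `A`. -/
theorem ZMod.sq_card_le_card_affine_notMem {q : ℕ} [Fact q.Prime]
    (A : Finset (ZMod q)) (hA : 2 ≤ #A) (hAq : 3 * #A ≤ 2 * q) (a b s : ZMod q)
    (ha : a ≠ 0) (hb : b ≠ 0) :
    #A ^ 2 ≤ 100 * #{p ∈ A ×ˢ A | a * p.1 + b * p.2 + s ∉ A} := by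
  by_contra! hlt
  set A' := {x ∈ A | 12 * #{y ∈ A | a * x + b * y + s ∉ A} < #A} with hA'
  have hsub : A' ⊆ A := filter_subset _ _
  have hsum : #{p ∈ A ×ˢ A | a * p.1 + b * p.2 + s ∉ A} =
      ∑ x ∈ A, #{y ∈ A | a * x + b * y + s ∉ A} := by
    simp only [card_filter, sum_product]
  -- Markov's inequality: fewer than 12% of the rows of `A ×ˢ A` can be bad.
  have hcard : 100 * (#A - #A') < 12 * #A := by
    have h1 : (#A - #A') * #A ≤ 12 * #{p ∈ A ×ˢ A | a * p.1 + b * p.2 + s ∉ A} := by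
      rw [hsum, mul_sum, ← card_sdiff_of_subset hsub, ← smul_eq_mul]
      refine (card_nsmul_le_sum (A \ A') _ _ fun x hx => ?_).trans
        (sum_le_sum_of_subset sdiff_subset)
      simp only [hA', mem_sdiff, mem_filter, not_and, not_lt] at hx
      exact hx.2 hx.1
    by_contra! h
    have := Nat.mul_le_mul_right #A h
    nlinarith
  have hle := card_le_card hsub
  have hne : A'.Nonempty := card_pos.1 (by omega)
  have key : (5 * #A / 6 + 1) * #(A' - A') ≤ #A * #A :=
    card_sub_mul_le_of_card_affine_notMem A A' a b s ha hb fun x hx => (mem_filter.1 hx).2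
  have hdiff' : 5 * #(A' - A') ≤ 6 * #A := by
    refine Nat.le_of_mul_le_mul_left (c := #A) ?_ (by omega)
    have h2 : 5 * #A ≤ 6 * (5 * #A / 6 + 1) := by omega
    have := Nat.mul_le_mul_right #(A' - A') h2
    nlinarith [key, this]
  -- The bound `6/5 #A` on the differences is below `q` since `#A ≤ 2q/3`, and below `2 #A' - 1 >
  -- 1.76 #A - 1` since `#A ≥ 2`.
  have hcd := ZMod.cauchy_davenport Fact.out hne hne.neg
  rw [card_neg, ← sub_eq_add_neg] at hcd
  omega

-- The Cauchy–Davenport bound and the preimage count for the complement are glued at `#A = 2q/3`.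
-- The factor `min #A (q - #A)` is also what controls the number of sets of this size.
open Finset in
theorem ZMod.min_mul_card_le_card_affine_notMem {q : ℕ} [Fact q.Prime]
    (A : Finset (ZMod q)) (hA : 2 ≤ #A) (a b s : ZMod q) (ha : a ≠ 0) (hb : b ≠ 0) :
    min #A (q - #A) * #A ≤ 100 * #{p ∈ A ×ˢ A | a * p.1 + b * p.2 + s ∉ A} := by
  rcases le_or_gt (3 * #A) (2 * q) with h | h
  · refine le_trans ?_ (ZMod.sq_card_le_card_affine_notMem A hA h a b s ha hb)
    rw [sq]
    gcongr
    exact min_le_left _ _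
  · have := mul_two_mul_sub_le_card_affine_notMem A a b s ha hb
    rw [ZMod.card] at this
    calc min #A (q - #A) * #A ≤ (q - #A) * (100 * (2 * #A - q)) := by
          gcongr
          · exact min_le_right _ _
          · omega
      _ = 100 * ((2 * #A - q) * (q - #A)) := by ring
      _ ≤ _ := by gcongr

/-! ### Two-increasing chains in large sets of vectors -/

/-- Relative to `w`, every vector of the sequence `v` deviates from `w` in two coordinates in which
all later vectors of the sequence agree with `w`. -/
def IsTwoIncreasingChain {F κ : Type*} {d : ℕ} (w : κ → F) (v : Fin d → κ → F) : Prop :=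
  ∀ j, ∃ a b, a ≠ b ∧ v j a ≠ w a ∧ v j b ≠ w b ∧ ∀ i, j < i → v i a = w a ∧ v i b = w b

open Finset in
/-- A set larger than a Hamming ball of radius one has a large two-coordinate fibre that is avoided
in both coordinates by some element of the set. -/
theorem exists_large_fiber_and_opposite {F κ : Type*} [Fintype F] [DecidableEq F] [Fintype κ]
    [DecidableEq κ] [Nonempty κ] {N : ℕ} (S : Finset (κ → F))
    (hS : Fintype.card κ * Fintype.card F < #S)
    (hN : Fintype.card F ^ 2 * N < #S) :
    ∃ a b α β, a ≠ b ∧ N < #{u ∈ S | u a = α ∧ u b = β} ∧ ∃ s ∈ S, s a ≠ α ∧ s b ≠ β := by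
  have hplural : ∀ a : κ, ∃ α, Fintype.card F * N < #{u ∈ S | u a = α} := by
    intro a
    obtain ⟨α, -, h⟩ := exists_lt_card_fiber_of_mul_lt_card_of_maps_to (s := S) (t := univ)
      (f := fun u => u a) (n := Fintype.card F * N) (fun _ _ => mem_univ _)
      (by rwa [card_univ, ← mul_assoc, ← sq])
    exact ⟨α, h⟩
  choose m hm using hplural
  have hfib : ∀ a b : κ, ∃ β, N < #{u ∈ S | u a = m a ∧ u b = β} := by
    intro a b
    obtain ⟨β, -, h⟩ := exists_lt_card_fiber_of_mul_lt_card_of_maps_to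
      (s := {u ∈ S | u a = m a}) (t := univ) (f := fun u => u b) (n := N)
      (fun _ _ => mem_univ _) (by simpa using hm a)
    exact ⟨β, by simpa [filter_filter] using h⟩
  -- Otherwise `S` lies in the Hamming ball of radius one around the vector `m` of popular values.
  obtain ⟨s, hs, a, b, hab, hsa, hsb⟩ :
      ∃ s ∈ S, ∃ a b, a ≠ b ∧ s a ≠ m a ∧ s b ≠ m b := by
    by_contra! hcon
    have hsub : S ⊆ (univ : Finset (κ × F)).image fun p => Function.update m p.1 p.2 := by
      intro s hs
      simp only [mem_image, mem_univ, true_and, Prod.exists]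
      by_cases h : ∃ a, s a ≠ m a
      · obtain ⟨a, ha⟩ := h
        refine ⟨a, s a, funext fun b => ?_⟩
        by_cases hb : b = a
        · subst hb; simp
        · rw [Function.update_of_ne hb]
          exact (hcon s hs a b (Ne.symm hb) ha).symm
      · push Not at h
        refine ⟨Classical.arbitrary κ, m (Classical.arbitrary κ), ?_⟩
        rw [Function.update_eq_self]
        exact (funext h).symm
    have := (card_le_card hsub).trans card_image_le
    rw [card_univ, Fintype.card_prod] at this
    omega
  obtain ⟨β, hβ⟩ := hfib a b
  -- If `s` agrees with `β` at `b`, use the popular fibre at `b` instead. If `s` also agrees with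
  -- that fibre's value `x` at `a`, any `u` of the second fibre avoids the first one in both
  -- coordinates.
  by_cases h1 : s b = β
  · obtain ⟨x, hx⟩ := hfib b a
    by_cases h2 : s a = x
    · obtain ⟨u, hu⟩ := card_pos.1 (Nat.zero_lt_of_lt hx)
      simp only [mem_filter] at hu
      refine ⟨a, b, m a, β, hab, hβ, u, hu.1, ?_, ?_⟩
      · rw [hu.2.2, ← h2]; exact hsa
      · rw [hu.2.1, ← h1]; exact hsb.symm
    · exact ⟨a, b, x, m b, hab, by simpa only [and_comm] using hx, s, hs, h2, hsb⟩
  · exact ⟨a, b, m a, β, hab, hβ, s, hs, hsa, h1⟩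

open Finset in
/-- Large sets of vectors contain long two-increasing chains. -/
theorem exists_isTwoIncreasingChain {F κ : Type*} [Fintype F] [DecidableEq F] [Fintype κ]
    [DecidableEq κ] [Nonempty κ] (d : ℕ) (S : Finset (κ → F))
    (hS : Fintype.card F ^ (2 * d) * (Fintype.card κ * Fintype.card F) < #S) :
    ∃ w ∈ S, ∃ v : Fin d → κ → F, (∀ j, v j ∈ S) ∧ IsTwoIncreasingChain w v := by
  induction d generalizing S with
  | zero =>
    obtain ⟨w, hw⟩ := card_pos.1 (Nat.zero_lt_of_lt hS)
    exact ⟨w, hw, Fin.elim0, fun j => j.elim0, fun j => j.elim0⟩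
  | succ d ih =>
    have hF : 0 < Fintype.card F := by
      obtain ⟨w, hw⟩ := card_pos.1 (Nat.zero_lt_of_lt hS)
      exact Fintype.card_pos_iff.2 ⟨w (Classical.arbitrary κ)⟩
    obtain ⟨a, b, α, β, hab, hcard, s, hs, hsa, hsb⟩ := exists_large_fiber_and_opposite S
      (N := Fintype.card F ^ (2 * d) * (Fintype.card κ * Fintype.card F))
      ((Nat.le_mul_of_pos_left _ (by positivity)).trans_lt hS) (by
        rw [← mul_assoc, ← pow_add]
        rwa [show 2 + 2 * d = 2 * (d + 1) by ring])
    obtain ⟨w, hw, v, hv, hchain⟩ := ih _ hcard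
    simp only [mem_filter] at hw hv
    -- The opposing vector `s` goes first: `w` and all later vectors lie in the fibre, hence agree
    -- at `a` and `b`.
    refine ⟨w, hw.1, Fin.cons s v, Fin.cases hs fun j => (hv j).1, Fin.cases ?_ fun j => ?_⟩
    · refine ⟨a, b, hab, ?_, ?_, Fin.cases (fun h => absurd h (lt_irrefl _)) fun i _ => ?_⟩
      · simpa [hw.2.1] using hsa
      · simpa [hw.2.2] using hsb
      · simp [hw.2, (hv i).2]
    · obtain ⟨a, b, hab, ha, hb, h⟩ := hchain j
      refine ⟨a, b, hab, by simpa using ha, by simpa using hb,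
        Fin.cases (fun h => absurd h (by simp)) fun i hi => ?_⟩
      simpa using h i (Fin.succ_lt_succ_iff.1 hi)

/-! ### Counting points that pass the tests of a chain -/

-- Resampling one coordinate preserves the uniform measure on a cube: swapping the old and the new
-- value is an involution.
open Finset in
theorem sum_piFinset_sum_update {F κ M : Type*} [DecidableEq F] [Fintype κ] [DecidableEq κ]
    [AddCommMonoid M] (A : Finset F) (a : κ) (f : (κ → F) → M) :
    ∑ x ∈ Fintype.piFinset (fun _ : κ => A), ∑ t ∈ A, f (Function.update x a t) =
      #A • ∑ x ∈ Fintype.piFinset (fun _ : κ => A), f x := by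
  have hmem : ∀ x ∈ Fintype.piFinset (fun _ : κ => A), ∀ t ∈ A,
      Function.update x a t ∈ Fintype.piFinset (fun _ : κ => A) := by
    intro x hx t ht
    rw [Fintype.mem_piFinset] at hx ⊢
    intro i
    by_cases h : i = a
    · subst h; simpa
    · simpa [h] using hx i
  rw [← sum_product', smul_sum]
  trans ∑ p ∈ Fintype.piFinset (fun _ : κ => A) ×ˢ A, f p.1
  · refine sum_nbij' (fun p => (Function.update p.1 a p.2, p.1 a))
      (fun p => (Function.update p.1 a p.2, p.1 a)) ?_ ?_ ?_ ?_ ?_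
    · rintro ⟨x, t⟩ h
      rw [mem_product] at h ⊢
      exact ⟨hmem x h.1 t h.2, Fintype.mem_piFinset.1 h.1 a⟩
    · rintro ⟨x, t⟩ h
      rw [mem_product] at h ⊢
      exact ⟨hmem x h.1 t h.2, Fintype.mem_piFinset.1 h.1 a⟩
    · simp
    · simp
    · simp
  · rw [sum_product]
    simp

open Finset in
/-- The number of points of a cube that satisfy the membership constraints given by a chain of
linear forms, each of which involves two coordinates not involved in the later ones. -/
theorem card_filter_piFinset_le_of_chain {F κ : Type*} [Field F] [DecidableEq F] [Fintype κ]
    [DecidableEq κ] (A : Finset F) {δ : ℝ} (hδ : 0 ≤ δ)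
    (hA : ∀ a b s : F, a ≠ 0 → b ≠ 0 →
      (#{p ∈ A ×ˢ A | a * p.1 + b * p.2 + s ∈ A} : ℝ) ≤ δ * #A ^ 2)
    (y : F) {d : ℕ} (u : Fin d → κ → F) (hu : IsTwoIncreasingChain 0 u) :
    (#{x ∈ Fintype.piFinset (fun _ : κ => A) | ∀ j, u j ⬝ᵥ x + y ∈ A} : ℝ) ≤
      δ ^ d * #A ^ Fintype.card κ := by
  induction d with
  | zero => simp
  | succ d ih =>
    rcases A.eq_empty_or_nonempty with rfl | hne
    · simp only [notMem_empty, forall_const, filter_false, card_empty, Nat.cast_zero]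
      positivity
    have ih' := ih (Fin.tail u) fun j => by
      obtain ⟨a, b, hab, ha, hb, h⟩ := hu j.succ
      exact ⟨a, b, hab, ha, hb, fun i hi => h i.succ (Fin.succ_lt_succ_iff.2 hi)⟩
    obtain ⟨a, b, hab, ha, hb, h⟩ := hu 0
    set P : (κ → F) → Prop := fun x => ∀ j, Fin.tail u j ⬝ᵥ x + y ∈ A with hP
    set Q : (κ → F) → Prop := fun x => u 0 ⬝ᵥ x + y ∈ A with hQ
    have hPQ : ∀ x, (∀ j, u j ⬝ᵥ x + y ∈ A) ↔ Q x ∧ P x := fun x => Fin.forall_fin_succ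
    have hdot : ∀ (c : κ → F) (x : κ → F) (i : κ) (t : F),
        c ⬝ᵥ Function.update x i t = c ⬝ᵥ x + c i * (t - x i) := by
      intro c x i t
      have : Function.update x i t = x + Pi.single i (t - x i) := by
        ext j
        by_cases hj : j = i
        · subst hj; simp
        · simp [hj]
      rw [this, dotProduct_add, dotProduct_single]
    -- The later forms vanish at `a` and `b`, so resampling these coordinates leaves `P` intact and
    -- tests the first form on two fresh variables.
    have hPu : ∀ x s t, P (Function.update (Function.update x a s) b t) ↔ P x := by
      intro x s t
      refine forall_congr' fun j => ?_
      have := h j.succ (Fin.succ_pos j)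
      simp only [Pi.zero_apply] at this
      simp [hdot, Fin.tail, this.1, this.2]
    classical
    set g : (κ → F) → ℝ := fun x => if Q x ∧ P x then 1 else 0 with hg
    have e1 : (#A : ℝ) ^ 2 * #{x ∈ Fintype.piFinset (fun _ : κ => A) | Q x ∧ P x} =
        ∑ x ∈ Fintype.piFinset (fun _ : κ => A), ∑ s ∈ A, ∑ t ∈ A,
          g (Function.update (Function.update x a s) b t) := by
      rw [sum_piFinset_sum_update A a fun x => ∑ t ∈ A, g (Function.update x b t),
        sum_piFinset_sum_update A b g, card_filter]
      simp [hg, sq, mul_assoc]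
    have e2 : ∀ x, ∑ s ∈ A, ∑ t ∈ A, g (Function.update (Function.update x a s) b t) ≤
        δ * #A ^ 2 * if P x then 1 else 0 := by
      intro x
      by_cases hx : P x
      · simp only [hg, hPu, hx, and_true, if_true, mul_one]
        refine le_trans (le_of_eq ?_) (hA (u 0 a) (u 0 b)
          (u 0 ⬝ᵥ x - u 0 a * x a - u 0 b * x b + y) ha hb)
        rw [← sum_product', card_filter, Nat.cast_sum]
        refine sum_congr rfl fun p _ => ?_
        have : u 0 ⬝ᵥ Function.update (Function.update x a p.1) b p.2 + y =
            u 0 a * p.1 + u 0 b * p.2 + (u 0 ⬝ᵥ x - u 0 a * x a - u 0 b * x b + y) := by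
          rw [hdot, hdot, Function.update_of_ne hab.symm]
          ring
        simp only [hQ, this]
        split_ifs <;> simp
      · simp [hg, hPu, hx]
    have e3 : (#A : ℝ) ^ 2 * #{x ∈ Fintype.piFinset (fun _ : κ => A) | Q x ∧ P x} ≤
        #A ^ 2 * (δ * #{x ∈ Fintype.piFinset (fun _ : κ => A) | P x}) := by
      rw [e1, card_filter]
      refine (sum_le_sum fun x _ => e2 x).trans (le_of_eq ?_)
      rw [← mul_sum]
      push_cast
      ring
    have hpos : (0 : ℝ) < #A ^ 2 := by
      have := hne.card_pos
      positivity
    have e4 := le_of_mul_le_mul_left e3 hpos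
    simp only [hPQ]
    calc _ ≤ _ := e4
      _ ≤ δ * (δ ^ d * #A ^ Fintype.card κ) := by gcongr
      _ = _ := by ring

-- Fixing `y = w ⬝ᵥ x` costs a factor `#A` and turns the `v j` into `v j - w`, a chain relative to
-- zero.
open Finset in
theorem card_filter_piFinset_le_of_isTwoIncreasingChain {F κ : Type*} [Field F] [DecidableEq F]
    [Fintype κ] [DecidableEq κ] (A : Finset F) {δ : ℝ} (hδ : 0 ≤ δ)
    (hA : ∀ a b s : F, a ≠ 0 → b ≠ 0 →
      (#{p ∈ A ×ˢ A | a * p.1 + b * p.2 + s ∈ A} : ℝ) ≤ δ * #A ^ 2)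
    {d : ℕ} (w : κ → F) (v : Fin d → κ → F) (hv : IsTwoIncreasingChain w v) :
    (#{x ∈ Fintype.piFinset (fun _ : κ => A) | w ⬝ᵥ x ∈ A ∧ ∀ j, v j ⬝ᵥ x ∈ A} : ℝ) ≤
      #A * δ ^ d * #A ^ Fintype.card κ := by
  have hu : IsTwoIncreasingChain 0 (fun j => v j - w) := by
    intro j
    obtain ⟨a, b, hab, ha, hb, h⟩ := hv j
    exact ⟨a, b, hab, sub_ne_zero.2 ha, sub_ne_zero.2 hb,
      fun i hi => ⟨sub_eq_zero.2 (h i hi).1, sub_eq_zero.2 (h i hi).2⟩⟩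
  have hsub : {x ∈ Fintype.piFinset (fun _ : κ => A) | w ⬝ᵥ x ∈ A ∧ ∀ j, v j ⬝ᵥ x ∈ A} ⊆
      A.biUnion fun y =>
        {x ∈ Fintype.piFinset (fun _ : κ => A) | ∀ j, (v j - w) ⬝ᵥ x + y ∈ A} := by
    intro x hx
    rw [mem_filter] at hx
    rw [mem_biUnion]
    refine ⟨w ⬝ᵥ x, hx.2.1, mem_filter.2 ⟨hx.1, fun j => ?_⟩⟩
    rw [sub_dotProduct, sub_add_cancel]
    exact hx.2.2 j
  calc _ ≤ ((∑ y ∈ A,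
        #{x ∈ Fintype.piFinset (fun _ : κ => A) | ∀ j, (v j - w) ⬝ᵥ x + y ∈ A} : ℕ) : ℝ) := by
        exact_mod_cast (card_le_card hsub).trans card_biUnion_le
    _ ≤ ∑ _y ∈ A, δ ^ d * #A ^ Fintype.card κ := by
        rw [Nat.cast_sum]
        exact sum_le_sum fun y _ => card_filter_piFinset_le_of_chain A hδ hA y _ hu
    _ = _ := by rw [sum_const, nsmul_eq_mul, mul_assoc]

open Finset in
/-- The number of tuples of points of a product set for which the combinations with coefficient
vectors `w` and `v j` lie in the product set as well. -/
theorem card_filter_piFinset_piFinset_le {F ι κ : Type*} [Field F] [Fintype F] [DecidableEq F]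
    [Fintype ι] [DecidableEq ι] [Fintype κ] [DecidableEq κ] (T : ι → Finset F) (G : Finset ι)
    {δ : ℝ} (hδ : 0 ≤ δ)
    (hA : ∀ i ∈ G, ∀ a b s : F, a ≠ 0 → b ≠ 0 →
      (#{p ∈ T i ×ˢ T i | a * p.1 + b * p.2 + s ∈ T i} : ℝ) ≤ δ * #(T i) ^ 2)
    {d : ℕ} (w : κ → F) (v : Fin d → κ → F) (hv : IsTwoIncreasingChain w v) :
    (#{X ∈ Fintype.piFinset (fun i => Fintype.piFinset fun _ : κ => T i) |
        ∀ i, w ⬝ᵥ X i ∈ T i ∧ ∀ j, v j ⬝ᵥ X i ∈ T i} : ℝ) ≤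
      (Fintype.card F * δ ^ d) ^ #G * (#(Fintype.piFinset T)) ^ Fintype.card κ := by
  have e : {X ∈ Fintype.piFinset (fun i => Fintype.piFinset fun _ : κ => T i) |
        ∀ i, w ⬝ᵥ X i ∈ T i ∧ ∀ j, v j ⬝ᵥ X i ∈ T i} =
      Fintype.piFinset fun i => {x ∈ Fintype.piFinset (fun _ : κ => T i) |
        w ⬝ᵥ x ∈ T i ∧ ∀ j, v j ⬝ᵥ x ∈ T i} := by
    ext X
    simp only [mem_filter, Fintype.mem_piFinset]
    exact forall_and.symm
  rw [e, Fintype.card_piFinset, Fintype.card_piFinset, Nat.cast_prod, Nat.cast_prod,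
    ← prod_pow]
  have e2 : ((Fintype.card F : ℝ) * δ ^ d) ^ #G =
      ∏ i, if i ∈ G then (Fintype.card F : ℝ) * δ ^ d else 1 := by
    rw [prod_ite_mem, univ_inter, prod_const]
  rw [e2, ← prod_mul_distrib]
  refine prod_le_prod (fun _ _ => by positivity) fun i _ => ?_
  split_ifs with hi
  · refine (card_filter_piFinset_le_of_isTwoIncreasingChain (T i) hδ (hA i hi) w v hv).trans ?_
    gcongr
    exact card_le_univ _
  · rw [one_mul]
    refine (Nat.cast_le.2 (card_filter_le _ _)).trans_eq ?_
    rw [Fintype.card_piFinset, prod_const, card_univ, Nat.cast_pow]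

/-! ### Kernels of random matrices and the union bound for fixed lists -/

open Finset in
/-- The proportion of matrices whose kernel contains given linearly independent vectors. -/
theorem card_filter_mulVec_eq_zero_mul_le {F ι κ ρ : Type*} [Field F] [Fintype F] [DecidableEq F]
    [Fintype ι] [DecidableEq ι] [Fintype κ] [DecidableEq κ] [Fintype ρ] [DecidableEq ρ]
    (X : κ → ι → F) (hX : LinearIndependent F X) :
    #{H : Matrix ρ ι F | ∀ j, H.mulVec (X j) = 0} *
        Fintype.card F ^ (Fintype.card κ * Fintype.card ρ) ≤
      Fintype.card (Matrix ρ ι F) := by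
  -- Here `g` sends `X j` to the `j`-th unit vector. If `H` kills every `X j`, then `H + Y g`
  -- determines `Y` by its values on the `X j`, so the translates by arbitrary `Y` are distinct.
  obtain ⟨g, hg⟩ := (Fintype.linearCombination F X).exists_leftInverse_of_injective
    (LinearMap.ker_eq_bot.2 hX.fintypeLinearCombination_injective)
  have hgX : ∀ j, g (X j) = Pi.single j 1 := by
    intro j
    have := LinearMap.congr_fun hg (Pi.single j 1)
    simpa using this
  have hmul : ∀ (Y : Matrix ρ κ F) j, (Y * LinearMap.toMatrix' g).mulVec (X j) = Y.col j := by
    intro Y j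
    rw [← Matrix.mulVec_mulVec, LinearMap.toMatrix'_mulVec, hgX, Matrix.mulVec_single_one]
  have hcard : Fintype.card F ^ (Fintype.card κ * Fintype.card ρ) =
      #(univ : Finset (Matrix ρ κ F)) := by
    rw [card_univ, ← Fintype.card_congr (Matrix.of : (ρ → κ → F) ≃ _), Fintype.card_fun,
      Fintype.card_fun, ← pow_mul]
  rw [hcard, ← card_product, ← card_univ]
  refine card_le_card_of_injOn (fun p => p.1 + p.2 * LinearMap.toMatrix' g)
    (fun _ _ => mem_coe.2 (mem_univ _)) ?_
  rintro ⟨H, Y⟩ h ⟨H', Y'⟩ h' heq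
  simp only [coe_product, coe_filter, mem_univ, true_and, coe_univ, Set.mem_prod,
    Set.mem_ofPred_eq, Set.mem_univ, and_true] at h h' heq
  have hY : Y = Y' := by
    ext r j
    have := congrArg (fun M => M.mulVec (X j) r) heq
    simpa [Matrix.add_mulVec, hmul, h j, h' j] using this
  subst hY
  simpa using heq

open Finset in
/-- Union bound over a family of linearly independent tuples. -/
theorem card_filter_exists_mulVec_eq_zero_mul_le {F ι κ ρ : Type*} [Field F] [Fintype F]
    [DecidableEq F] [Fintype ι] [DecidableEq ι] [Fintype κ] [DecidableEq κ] [Fintype ρ]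
    [DecidableEq ρ] (E : Finset (κ → ι → F)) (hE : ∀ X ∈ E, LinearIndependent F X) :
    #{H : Matrix ρ ι F | ∃ X ∈ E, ∀ j, H.mulVec (X j) = 0} *
        Fintype.card F ^ (Fintype.card κ * Fintype.card ρ) ≤
      #E * Fintype.card (Matrix ρ ι F) := by
  have hsub : ({H | ∃ X ∈ E, ∀ j, H.mulVec (X j) = 0} : Finset (Matrix ρ ι F)) ⊆
      E.biUnion fun X => {H | ∀ j, H.mulVec (X j) = 0} := by
    intro H hH
    obtain ⟨X, hX, h⟩ := (mem_filter.1 hH).2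
    exact mem_biUnion.2 ⟨X, hX, mem_filter.2 ⟨mem_univ _, h⟩⟩
  calc _ ≤ (∑ X ∈ E, #{H : Matrix ρ ι F | ∀ j, H.mulVec (X j) = 0}) *
        Fintype.card F ^ (Fintype.card κ * Fintype.card ρ) :=
        Nat.mul_le_mul_right _ ((card_le_card hsub).trans card_biUnion_le)
    _ ≤ _ := by
        rw [sum_mul, ← smul_eq_mul (#E)]
        exact sum_le_card_nsmul _ _ _ fun X hX => card_filter_mulVec_eq_zero_mul_le X (hE X hX)

/-- The tuple `X` consists of linearly independent points of the product set of `T`. -/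
def IsIndependentTuple {F ι κ : Type*} [Field F] (T : ι → Finset F) (X : κ → ι → F) : Prop :=
  LinearIndependent F X ∧ ∀ j i, X j i ∈ T i

/-- The combinations of the tuple `X` with the coefficient vectors of some two-increasing chain of
length `d` lie in the product set of `T`. -/
def HasChainInProduct {F ι κ : Type*} [Field F] [Fintype κ] (d : ℕ) (T : ι → Finset F)
    (X : κ → ι → F) : Prop :=
  ∃ (w : κ → F) (v : Fin d → κ → F), IsTwoIncreasingChain w v ∧
    ∀ i, (w ⬝ᵥ fun k => X k i) ∈ T i ∧ ∀ j, (v j ⬝ᵥ fun k => X k i) ∈ T i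

open Finset Classical in
theorem card_isIndependentTuple_le {F ι κ : Type*} [Field F] [Fintype F]
    [Fintype ι] [Fintype κ] (T : ι → Finset F) :
    #{X : κ → ι → F | IsIndependentTuple T X} ≤ #(Fintype.piFinset T) ^ Fintype.card κ := by
  have : ({X | IsIndependentTuple T X} : Finset (κ → ι → F)) ⊆
      Fintype.piFinset fun _ => Fintype.piFinset T := fun X hX =>
    Fintype.mem_piFinset.2 fun j => Fintype.mem_piFinset.2 ((mem_filter.1 hX).2.2 j)
  refine (card_le_card this).trans_eq ?_
  rw [Fintype.card_piFinset, prod_const, card_univ]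

-- A union bound over the `d + 1` coefficient vectors; transposing the tuple decouples the positions
-- `i`.
open Finset Classical in
theorem card_hasChainInProduct_le {F ι κ : Type*} [Field F] [Fintype F]
    [Fintype ι] [Fintype κ] (T : ι → Finset F) (G : Finset ι) {δ : ℝ} (hδ : 0 ≤ δ)
    (hA : ∀ i ∈ G, ∀ a b s : F, a ≠ 0 → b ≠ 0 →
      (#{p ∈ T i ×ˢ T i | a * p.1 + b * p.2 + s ∈ T i} : ℝ) ≤ δ * #(T i) ^ 2) (d : ℕ) :
    (#{X : κ → ι → F | IsIndependentTuple T X ∧ HasChainInProduct d T X} : ℝ) ≤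
      Fintype.card F ^ (Fintype.card κ * (d + 1)) * ((Fintype.card F * δ ^ d) ^ #G *
        (#(Fintype.piFinset T)) ^ Fintype.card κ) := by
  set B : (κ → F) × (Fin d → κ → F) → Finset (ι → κ → F) := fun p =>
    {X ∈ Fintype.piFinset (fun i => Fintype.piFinset fun _ : κ => T i) |
        ∀ i, p.1 ⬝ᵥ X i ∈ T i ∧ ∀ j, p.2 j ⬝ᵥ X i ∈ T i} with hB
  set P : Finset ((κ → F) × (Fin d → κ → F)) := {p | IsTwoIncreasingChain p.1 p.2} with hP
  have h1 : #{X : κ → ι → F | IsIndependentTuple T X ∧ HasChainInProduct d T X} ≤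
      #(P.biUnion B) := by
    refine card_le_card_of_injOn (fun X i k => X k i) (fun X hX => ?_)
      fun X _ Y _ h => funext fun k => funext fun i => congrFun (congrFun h i) k
    obtain ⟨-, ⟨-, hT⟩, w, v, hwv, h⟩ := mem_filter.1 hX
    exact mem_coe.2 (mem_biUnion.2 ⟨(w, v), mem_filter.2 ⟨mem_univ _, hwv⟩, mem_filter.2
      ⟨Fintype.mem_piFinset.2 fun i => Fintype.mem_piFinset.2 fun k => hT k i, h⟩⟩)
  have h2 : (#P : ℝ) ≤ Fintype.card F ^ (Fintype.card κ * (d + 1)) := by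
    have : #P ≤ Fintype.card F ^ (Fintype.card κ * (d + 1)) := by
      refine (card_le_univ P).trans_eq ?_
      rw [Fintype.card_prod, Fintype.card_fun, Fintype.card_fun, Fintype.card_fun,
        Fintype.card_fin, ← pow_mul, ← pow_add]
      congr 1
      ring
    exact_mod_cast this
  calc _ ≤ ((∑ p ∈ P, #(B p) : ℕ) : ℝ) := by exact_mod_cast h1.trans card_biUnion_le
    _ ≤ ∑ _p ∈ P, (Fintype.card F * δ ^ d) ^ #G * (#(Fintype.piFinset T) : ℝ) ^ Fintype.card κ := by
        rw [Nat.cast_sum]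
        exact sum_le_sum fun p hp =>
          card_filter_piFinset_piFinset_le T G hδ hA p.1 p.2 (mem_filter.1 hp).2
    _ ≤ _ := by
        rw [sum_const, nsmul_eq_mul]
        gcongr

/-- A large intersection of a kernel with a product set contains many independent points, or few
independent points spanning the elements of a two-increasing chain. -/
theorem exists_isIndependentTuple_or_hasChainInProduct {F ι ρ : Type*} [Field F] [Fintype F]
    [Fintype ι] [Fintype ρ] (T : ι → Finset F) (H : Matrix ρ ι F) (d k : ℕ) (hk : 0 < k)
    (hcard : Fintype.card F ^ (2 * d) * (k * Fintype.card F) <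
      ((LinearMap.ker H.mulVecLin : Set (ι → F)) ∩ {x | ∀ i, x i ∈ T i}).ncard) :
    (∃ X : Fin k → ι → F, IsIndependentTuple T X ∧ ∀ j, H.mulVec (X j) = 0) ∨
    ∃ r ∈ Finset.Ico 1 k, ∃ X : Fin r → ι → F,
      (IsIndependentTuple T X ∧ HasChainInProduct d T X) ∧ ∀ j, H.mulVec (X j) = 0 := by
  classical
  set s : Set (ι → F) := (LinearMap.ker H.mulVecLin : Set (ι → F)) ∩ {x | ∀ i, x i ∈ T i} with hs
  obtain ⟨f, hf, hspan, hind⟩ := Submodule.exists_fun_fin_finrank_span_eq F s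
  generalize Module.finrank F (Submodule.span F s) = r at f hf hspan hind
  have hker : ∀ j, H.mulVec (f j) = 0 := fun j => by simpa using (hf j).1
  have hT : ∀ j i, f j i ∈ T i := fun j => (hf j).2
  rcases le_or_gt k r with hkr | hkr
  · exact .inl ⟨f ∘ Fin.castLE hkr, ⟨hind.comp _ (Fin.castLE_injective hkr), fun j => hT _⟩,
      fun j => hker _⟩
  right
  -- In the basis `f`, taken from `s` itself, points of `s` become coefficient vectors, and the
  -- chain is sought among these.
  set S : Finset (Fin r → F) := {u | ∀ i, (u ⬝ᵥ fun j => f j i) ∈ T i} with hS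
  have hsS : s.ncard ≤ S.card := by
    have hsub : s ⊆ (fun u : Fin r → F => ∑ j, u j • f j) '' (S : Set (Fin r → F)) := by
      intro x hx
      have hx' : x ∈ Submodule.span F (Set.range f) := hspan ▸ Submodule.subset_span hx
      obtain ⟨c, rfl⟩ := (Submodule.mem_span_range_iff_exists_fun F).1 hx'
      refine ⟨c, ?_, rfl⟩
      have := hx.2
      simpa [hS, dotProduct] using this
    calc s.ncard ≤ _ := Set.ncard_le_ncard hsub
      _ ≤ (S : Set (Fin r → F)).ncard := Set.ncard_image_le
      _ = S.card := Set.ncard_coe_finset S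
  have hF : 0 < Fintype.card F := Fintype.card_pos
  have hr : 1 ≤ r := by
    by_contra! h0
    obtain rfl : r = 0 := by omega
    have h1 : S.card ≤ 1 := Finset.card_le_one_of_subsingleton S
    have : 0 < Fintype.card F ^ (2 * d) * (k * Fintype.card F) := by positivity
    omega
  have : Nonempty (Fin r) := ⟨⟨0, hr⟩⟩
  obtain ⟨w, hw, v, hv, hwv⟩ := exists_isTwoIncreasingChain d S (by
    rw [Fintype.card_fin]
    refine lt_of_le_of_lt ?_ (hcard.trans_le hsS)
    gcongr)
  refine ⟨r, Finset.mem_Ico.2 ⟨hr, hkr⟩, f, ⟨⟨hind, hT⟩, w, v, hwv, fun i => ?_⟩, hker⟩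
  simp only [hS, Finset.mem_filter, Finset.mem_univ, true_and] at hw hv
  exact ⟨hw i, fun j => hv j i⟩

open Finset Classical in
/-- The proportion of matrices whose kernel meets a given product set in many points. -/
theorem card_filter_lt_ncard_ker_inter_le {F ι ρ : Type*} [Field F] [Fintype F]
    [DecidableEq F] [Fintype ι] [DecidableEq ι] [Fintype ρ] [DecidableEq ρ]
    (T : ι → Finset F) (G : Finset ι) {δ τ : ℝ} (hδ : 0 ≤ δ)
    (hA : ∀ i ∈ G, ∀ a b s : F, a ≠ 0 → b ≠ 0 →
      (#{p ∈ T i ×ˢ T i | a * p.1 + b * p.2 + s ∈ T i} : ℝ) ≤ δ * #(T i) ^ 2)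
    (hτ : (#(Fintype.piFinset T) : ℝ) = τ * Fintype.card F ^ Fintype.card ρ)
    (d k : ℕ) (hk : 0 < k) :
    (#{H : Matrix ρ ι F | Fintype.card F ^ (2 * d) * (k * Fintype.card F) <
      ((LinearMap.ker H.mulVecLin : Set (ι → F)) ∩ {x | ∀ i, x i ∈ T i}).ncard} : ℝ) ≤
    (τ ^ k + ∑ r ∈ Ico 1 k, Fintype.card F ^ (r * (d + 1)) *
      (Fintype.card F * δ ^ d) ^ #G * τ ^ r) * Fintype.card (Matrix ρ ι F) := by
  have hF : (0 : ℝ) < Fintype.card F := by exact_mod_cast Fintype.card_pos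
  have huse : ∀ (r : ℕ) (E : Finset (Fin r → ι → F)) (c : ℝ),
      (∀ X ∈ E, LinearIndependent F X) → (#E : ℝ) ≤ c * #(Fintype.piFinset T) ^ r →
      (#{H : Matrix ρ ι F | ∃ X ∈ E, ∀ j, H.mulVec (X j) = 0} : ℝ) ≤
        c * τ ^ r * Fintype.card (Matrix ρ ι F) := by
    intro r E c hE hc
    have h1 : (#{H : Matrix ρ ι F | ∃ X ∈ E, ∀ j, H.mulVec (X j) = 0} : ℝ) *
        (Fintype.card F : ℝ) ^ (r * Fintype.card ρ) ≤ #E * Fintype.card (Matrix ρ ι F) := by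
      have := card_filter_exists_mulVec_eq_zero_mul_le (ρ := ρ) E hE
      rw [Fintype.card_fin] at this
      exact_mod_cast this
    have h2 : (0 : ℝ) < (Fintype.card F : ℝ) ^ (r * Fintype.card ρ) := by positivity
    refine le_of_mul_le_mul_right (h1.trans ?_) h2
    calc _ ≤ c * #(Fintype.piFinset T) ^ r * (Fintype.card (Matrix ρ ι F) : ℝ) := by gcongr
      _ = _ := by rw [hτ, mul_pow, ← pow_mul, mul_comm (Fintype.card ρ)]; ring
  set E₁ : Finset (Fin k → ι → F) := {X | IsIndependentTuple T X} with hE₁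
  set E₂ : ∀ r, Finset (Fin r → ι → F) :=
    fun r => {X | IsIndependentTuple T X ∧ HasChainInProduct d T X} with hE₂
  have hsub : ({H | Fintype.card F ^ (2 * d) * (k * Fintype.card F) <
      ((LinearMap.ker H.mulVecLin : Set (ι → F)) ∩ {x | ∀ i, x i ∈ T i}).ncard} :
        Finset (Matrix ρ ι F)) ⊆
      ({H | ∃ X ∈ E₁, ∀ j, H.mulVec (X j) = 0} : Finset (Matrix ρ ι F)) ∪
        (Ico 1 k).biUnion fun r => {H | ∃ X ∈ E₂ r, ∀ j, H.mulVec (X j) = 0} := by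
    intro H hH
    rw [mem_union, mem_biUnion]
    rcases exists_isIndependentTuple_or_hasChainInProduct T H d k hk (mem_filter.1 hH).2 with
      ⟨X, hX, h⟩ | ⟨r, hr, X, hX, h⟩
    · exact .inl (mem_filter.2 ⟨mem_univ _, X, mem_filter.2 ⟨mem_univ _, hX⟩, h⟩)
    · exact .inr ⟨r, hr, mem_filter.2 ⟨mem_univ _, X, mem_filter.2 ⟨mem_univ _, hX⟩, h⟩⟩
  have hcard := (card_le_card hsub).trans ((card_union_le _ _).trans
    (Nat.add_le_add_left card_biUnion_le _))
  refine (Nat.cast_le.2 hcard).trans ?_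
  rw [Nat.cast_add, Nat.cast_sum, add_mul, sum_mul]
  refine add_le_add ?_ (sum_le_sum fun r _ => ?_)
  · refine (huse k E₁ 1 (fun X hX => (mem_filter.1 hX).2.1) ?_).trans_eq (by rw [one_mul])
    have := card_isIndependentTuple_le (κ := Fin k) T
    rw [Fintype.card_fin] at this
    rw [one_mul, ← Nat.cast_pow, Nat.cast_le]
    convert this
  · refine huse r (E₂ r) _ (fun X hX => (mem_filter.1 hX).2.1.1) ?_
    have := card_hasChainInProduct_le (κ := Fin r) T G hδ
      (fun i hi a b s ha hb => by convert hA i hi a b s ha hb) d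
    rw [Fintype.card_fin, ← mul_assoc] at this
    convert this

/-! ### Input lists over the prime field -/

open Finset in
theorem ZMod.card_affine_mem_le {q : ℕ} [Fact q.Prime] (A : Finset (ZMod q)) (hA : 2 ≤ #A)
    (a b s : ZMod q) (ha : a ≠ 0) (hb : b ≠ 0) :
    (#{p ∈ A ×ˢ A | a * p.1 + b * p.2 + s ∈ A} : ℝ) ≤
      (1 - (min #A (q - #A) : ℕ) / (100 * #A)) * #A ^ 2 := by
  have h1 := ZMod.min_mul_card_le_card_affine_notMem A hA a b s ha hb
  have h2 := card_filter_add_card_filter_not (s := A ×ˢ A) fun p => a * p.1 + b * p.2 + s ∈ A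
  rw [card_product] at h2
  have h1' : ((min #A (q - #A) : ℕ) : ℝ) * #A ≤
      100 * #{p ∈ A ×ˢ A | a * p.1 + b * p.2 + s ∉ A} := by exact_mod_cast h1
  have h2' : (#{p ∈ A ×ˢ A | a * p.1 + b * p.2 + s ∈ A} : ℝ) +
      #{p ∈ A ×ˢ A | a * p.1 + b * p.2 + s ∉ A} = #A * #A := by exact_mod_cast h2
  have hpos : (0 : ℝ) < #A := by
    have : 0 < #A := by omega
    exact_mod_cast this
  have e : (1 - ((min #A (q - #A) : ℕ) : ℝ) / (100 * #A)) * #A ^ 2 =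
      #A * #A - (min #A (q - #A) : ℕ) * #A / 100 := by
    field_simp
  rw [e]
  linarith

open Finset in
/-- The input lists for list recovery from erasures whose proper lists have size exactly `ℓ`. -/
def erasureLists (q n ℓ : ℕ) [NeZero q] : Finset (Fin n → Finset (ZMod q)) :=
  Fintype.piFinset fun _ => insert univ (powersetCard ℓ univ)

-- The symmetry of binomial coefficients puts `min ℓ (q - ℓ)` in the exponent; the factor 2 pays for
-- the full list.
open Finset in
theorem card_erasureLists_le (q n ℓ : ℕ) [NeZero q] (hℓ : 1 ≤ ℓ) (hℓq : ℓ < q) :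
    #(erasureLists q n ℓ) ≤ q ^ (2 * min ℓ (q - ℓ) * n) := by
  have hchoose : q.choose ℓ ≤ q ^ min ℓ (q - ℓ) := by
    rcases min_choice ℓ (q - ℓ) with h | h <;> rw [h]
    · exact Nat.choose_le_pow _ _
    · rw [← Nat.choose_symm hℓq.le]
      exact Nat.choose_le_pow _ _
  rw [erasureLists, Fintype.card_piFinset, prod_const, card_univ, Fintype.card_fin, pow_mul]
  refine Nat.pow_le_pow_left ?_ n
  calc _ ≤ #(powersetCard ℓ (univ : Finset (ZMod q))) + 1 := card_insert_le _ _
    _ ≤ q ^ min ℓ (q - ℓ) + 1 := by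
        rw [card_powersetCard, card_univ, ZMod.card]
        omega
    _ ≤ q ^ min ℓ (q - ℓ) * q ^ min ℓ (q - ℓ) := by
        have : 2 ≤ q ^ min ℓ (q - ℓ) :=
          (by omega : 2 ≤ q).trans (Nat.le_self_pow (by omega) q)
        nlinarith
    _ = _ := by rw [← pow_add, two_mul]

open Finset in
/-- The size of a product of input lists, measured against the capacity. -/
theorem card_piFinset_le_rpow {q n ℓ : ℕ} [NeZero q] {α : ℝ} (hℓ : 1 ≤ ℓ) (hℓq : ℓ < q)
    (T : Fin n → Finset (ZMod q)) (hT : T ∈ erasureLists q n ℓ)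
    (hG : (1 - α) * n ≤ #{i | #(T i) = ℓ}) :
    (#(Fintype.piFinset T) : ℝ) ≤ (q : ℝ) ^ ((α + (1 - α) * Real.logb q ℓ) * n) := by
  have hq : (1 : ℝ) < q := by exact_mod_cast (by omega : 1 < q)
  have hlog : Real.logb q ℓ ≤ 1 := by
    rw [Real.logb_le_iff_le_rpow hq (by exact_mod_cast hℓ), Real.rpow_one]
    exact_mod_cast hℓq.le
  have hcard : ∀ i, (#(T i) : ℝ) = (q : ℝ) ^ (if #(T i) = ℓ then Real.logb q ℓ else 1) := by
    intro i
    split_ifs with h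
    · rw [h, Real.rpow_logb (by linarith) hq.ne' (by exact_mod_cast hℓ)]
    · rcases mem_insert.1 (Fintype.mem_piFinset.1 hT i) with h' | h'
      · rw [h', card_univ, ZMod.card, Real.rpow_one]
      · exact absurd (mem_powersetCard.1 h').2 h
  rw [Fintype.card_piFinset, Nat.cast_prod, prod_congr rfl fun i _ => hcard i,
    ← Real.rpow_sum_of_pos (by linarith)]
  refine Real.rpow_le_rpow_of_exponent_le hq.le ?_
  have e : ∀ i, (if #(T i) = ℓ then Real.logb q ℓ else 1) =
      1 - if #(T i) = ℓ then 1 - Real.logb q ℓ else 0 := by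
    intro i; split_ifs <;> ring
  rw [sum_congr rfl fun i _ => e i, sum_sub_distrib, ← sum_filter, sum_const, sum_const,
    card_univ, Fintype.card_fin, nsmul_eq_mul, nsmul_eq_mul, mul_one]
  nlinarith

open Finset in
/-- Shrinking the class of input lists: it suffices to consider proper lists of size exactly
`ℓ`. -/
theorem exists_mem_erasureLists_of_not_isListRecoverableFromErasures {q n ℓ : ℕ} [NeZero q]
    (hℓq : ℓ < q) {α L : ℝ} {𝒞 : Set (Fin n → ZMod q)}
    (h : ¬ IsListRecoverableFromErasures 𝒞 α ℓ L) :
    ∃ T ∈ erasureLists q n ℓ, (1 - α) * n ≤ #{i | #(T i) = ℓ} ∧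
      L < (𝒞 ∩ {x | ∀ i, x i ∈ T i}).ncard := by
  rw [IsListRecoverableFromErasures] at h
  push Not at h
  obtain ⟨T, G, hG, hT, hT', hL⟩ := h
  have hex : ∀ i, ∃ t : Finset (ZMod q), T i ⊆ t ∧
      ((i ∈ G → #t = ℓ) ∧ t ∈ insert univ (powersetCard ℓ (univ : Finset (ZMod q)))) := by
    intro i
    by_cases hi : i ∈ G
    · obtain ⟨t, ht, htc⟩ := exists_superset_card_eq (hT i hi) (by rw [ZMod.card]; exact hℓq.le)
      exact ⟨t, ht, fun _ => htc, mem_insert_of_mem (mem_powersetCard.2 ⟨subset_univ _, htc⟩)⟩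
    · exact ⟨univ, subset_univ _, fun h => absurd h hi, mem_insert_self _ _⟩
  choose T' hTT' hcard hmem using hex
  refine ⟨T', Fintype.mem_piFinset.2 hmem, hG.trans ?_, hL.trans_le ?_⟩
  · exact Nat.cast_le.2 (card_le_card fun i hi => mem_filter.2 ⟨mem_univ _, hcard i hi⟩)
  · exact Nat.cast_le.2 (Set.ncard_le_ncard
      (Set.inter_subset_inter_right _ fun x hx i => hTT' i (hx i)))

/-! ### Choice of parameters -/

/-- The length of the two-increasing chains used for erasure fraction `α` and input lists of size `ℓ`. -/
noncomputable def erasureChainLength (q ℓ : ℕ) (α : ℝ) : ℕ :=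
  ⌈700 * ℓ * Real.logb 2 q / (1 - α)⌉₊

/-- By `1 - x ≤ exp (-x)`, the 700 in the chain length divided by the 100 in the base leaves the
exponent 7. -/
theorem pow_erasureChainLength_le {q ℓ m n g : ℕ} {α : ℝ} (hq : 2 ≤ q) (hℓ : 1 ≤ ℓ) (hm : m ≤ ℓ)
    (hα : α < 1) (hg : (1 - α) * n ≤ g) :
    ((1 - m / (100 * ℓ) : ℝ) ^ erasureChainLength q ℓ α) ^ g ≤ ((q : ℝ) ^ (7 * m * n))⁻¹ := by
  set d := erasureChainLength q ℓ α with hd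
  have hℓ' : (0 : ℝ) < ℓ := by exact_mod_cast hℓ
  have hq' : (0 : ℝ) < q := by exact_mod_cast (by omega : 0 < q)
  have hm' : (m : ℝ) ≤ ℓ := by exact_mod_cast hm
  have hbase : (0 : ℝ) ≤ 1 - m / (100 * ℓ) := by
    rw [sub_nonneg, div_le_one (by positivity)]
    linarith
  have hlog0 : 0 ≤ Real.log q := Real.log_natCast_nonneg q
  have hlog : Real.log q ≤ Real.logb 2 q := by
    rw [Real.logb, le_div_iff₀ (Real.log_pos one_lt_two)]
    have := Real.log_two_lt_d9
    nlinarith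
  have hdg : 700 * ℓ * Real.log q * n ≤ d * g := by
    have h1 : 700 * ℓ * Real.logb 2 q ≤ d * (1 - α) := by
      rw [← div_le_iff₀ (by linarith)]
      exact Nat.le_ceil _
    calc 700 * ℓ * Real.log q * n ≤ 700 * ℓ * Real.logb 2 q * n := by gcongr
      _ ≤ d * (1 - α) * n := by gcongr
      _ = d * ((1 - α) * n) := by ring
      _ ≤ d * g := by gcongr
  rw [← pow_mul]
  calc (1 - m / (100 * ℓ) : ℝ) ^ (d * g) ≤ Real.exp (-(m / (100 * ℓ))) ^ (d * g) :=
        pow_le_pow_left₀ hbase (Real.one_sub_le_exp_neg _) _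
    _ = Real.exp (-(m / (100 * ℓ) * (d * g))) := by
        rw [← Real.exp_nat_mul]
        push_cast
        ring_nf
    _ ≤ Real.exp (-(m / (100 * ℓ) * (700 * ℓ * Real.log q * n))) := by gcongr
    _ = ((q : ℝ) ^ (7 * m * n))⁻¹ := by
        rw [Real.exp_neg, ← Real.exp_log (pow_pos hq' (7 * m * n)), Real.log_pow]
        congr 2
        push_cast
        field_simp
        ring

open Finset in
/-- The union bound over the ranks, in terms of the decay rates of its two parts. -/
theorem pow_add_sum_le_of_decay {q n m k d g : ℕ} {ε τ δ : ℝ} (hq : 2 ≤ q) (hm : 1 ≤ m)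
    (hε : 0 ≤ ε) (hkε : (2 * m + 2 : ℝ) ≤ ε * k) (hkn : k * (d + 1) ≤ n) (hgn : g ≤ n)
    (hδ0 : 0 ≤ δ) (hτ0 : 0 ≤ τ) (hτε : τ ≤ (q : ℝ) ^ (-(ε * n)))
    (hdec : (δ ^ d) ^ g ≤ ((q : ℝ) ^ (7 * m * n))⁻¹) :
    τ ^ k + ∑ r ∈ Ico 1 k, (q : ℝ) ^ (r * (d + 1)) * (q * δ ^ d) ^ g * τ ^ r ≤
      2 * ((q : ℝ) ^ ((2 * m + 2) * n))⁻¹ := by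
  have hq1 : (1 : ℝ) < q := by exact_mod_cast (by omega : 1 < q)
  have hq0 : (0 : ℝ) < q := by linarith
  have hτ1 : τ ≤ 1 := hτε.trans (Real.rpow_le_one_of_one_le_of_nonpos hq1.le (by
    rw [neg_nonpos]; positivity))
  rw [two_mul]
  refine add_le_add ?_ ?_
  · calc τ ^ k ≤ ((q : ℝ) ^ (-(ε * n))) ^ k := by gcongr
      _ = (q : ℝ) ^ (-(ε * k * n)) := by
          rw [← Real.rpow_mul_natCast hq0.le]
          ring_nf
      _ ≤ (q : ℝ) ^ (-((2 * m + 2) * n) : ℝ) := by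
          refine Real.rpow_le_rpow_of_exponent_le hq1.le ?_
          rw [neg_le_neg_iff]
          gcongr
      _ = _ := by
          rw [Real.rpow_neg hq0.le, ← Real.rpow_natCast]
          push_cast
          rfl
  · have hdec' : ((q : ℝ) * δ ^ d) ^ g ≤ q ^ n * ((q : ℝ) ^ (7 * m * n))⁻¹ := by
      rw [mul_pow]
      gcongr
      exact hq1.le
    calc ∑ r ∈ Ico 1 k, (q : ℝ) ^ (r * (d + 1)) * (q * δ ^ d) ^ g * τ ^ r
        ≤ ∑ r ∈ Ico 1 k, (q : ℝ) ^ n * (q ^ n * ((q : ℝ) ^ (7 * m * n))⁻¹) * 1 := by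
          refine sum_le_sum fun r hr => ?_
          have hr' := mem_Ico.1 hr
          gcongr
          · exact hq1.le
          · exact (Nat.mul_le_mul_right _ hr'.2.le).trans hkn
          · exact pow_le_one₀ hτ0 hτ1
      _ ≤ (q : ℝ) ^ n * (q ^ n * (q ^ n * ((q : ℝ) ^ (7 * m * n))⁻¹)) := by
          rw [sum_const, nsmul_eq_mul, mul_one]
          gcongr
          rw [Nat.card_Ico]
          have h1 : n < q ^ n := Nat.lt_pow_self (by omega)
          have h2 : k ≤ n := (Nat.le_mul_of_pos_right k (Nat.succ_pos d)).trans hkn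
          exact_mod_cast (by omega : k - 1 ≤ q ^ n)
      -- One `q ^ n` each for the coefficient vectors, the factor `q ^ g` and the number of ranks;
      -- the 7 is chosen so that `3 + (2 m + 2) ≤ 7 m` for `m ≥ 1`.
      _ = (q : ℝ) ^ (3 * n) * ((q : ℝ) ^ (7 * m * n))⁻¹ := by
          rw [pow_mul']; ring
      _ ≤ ((q : ℝ) ^ ((2 * m + 2) * n))⁻¹ := by
          rw [← div_eq_mul_inv, div_le_iff₀ (by positivity), ← div_eq_inv_mul,
            le_div_iff₀ (by positivity), ← pow_add]
          refine pow_le_pow_right₀ hq1.le ?_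
          rw [← add_mul]
          exact Nat.mul_le_mul_right n (by omega)

open Finset Classical in
/-- The proportion of matrices whose kernel is not list-recoverable from erasures. -/
theorem card_not_isListRecoverableFromErasures_le {q ℓ n N : ℕ} [Fact q.Prime] {α ε : ℝ}
    (hℓ : 2 ≤ ℓ) (hℓq : ℓ < q) (hα : α < 1) (hε : 0 < ε) (hε1 : ε < 1)
    (hn : (q : ℝ) ^ (2 * erasureChainLength q ℓ α + 3) * (1 / ε) ≤ n)
    (hN : (α + (1 - α) * Real.logb q ℓ + ε) * n ≤ N) :
    (#{H : Matrix (Fin N) (Fin n) (ZMod q) |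
        ¬ IsListRecoverableFromErasures (LinearMap.ker H.mulVecLin : Set (Fin n → ZMod q)) α ℓ
          ((q : ℝ) ^ (2 * erasureChainLength q ℓ α + 3) * (1 / ε))} : ℝ) ≤
      ((q : ℝ) ^ n)⁻¹ * Fintype.card (Matrix (Fin N) (Fin n) (ZMod q)) := by
  set d := erasureChainLength q ℓ α with hd
  set m := min ℓ (q - ℓ) with hm
  have hm1 : 1 ≤ m := by omega
  have hmq : 2 * m + 3 ≤ q ^ 2 := by
    have : 2 * m ≤ q := by omega
    nlinarith
  have hq1 : (1 : ℝ) < q := by exact_mod_cast (by omega : 1 < q)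
  have hq0 : (0 : ℝ) < q := by linarith
  -- Makes `τ ^ k ≤ q ^ (-(2 m + 2) n)`: `2 m n` for the number of lists, `n` for the factor 2, `n`
  -- for the final probability.
  set k := ⌈(2 * m + 2) / ε⌉₊ with hk
  have hkpos : 0 < k := Nat.ceil_pos.2 (by positivity)
  have hkε : (2 * m + 2 : ℝ) ≤ ε * k := by
    rw [← div_le_iff₀' hε]
    exact Nat.le_ceil _
  have hk_le : (k : ℝ) ≤ q ^ 2 * (1 / ε) := by
    have h1 : (k : ℝ) < (2 * m + 2) / ε + 1 := Nat.ceil_lt_add_one (by positivity)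
    have h2 : (1 : ℝ) ≤ 1 / ε := by rw [le_div_iff₀ hε]; linarith
    have h3 : (2 * m + 3 : ℝ) ≤ q ^ 2 := by exact_mod_cast hmq
    calc (k : ℝ) ≤ (2 * m + 3) * (1 / ε) := by
          have : (2 * m + 2 : ℝ) / ε = (2 * m + 2) * (1 / ε) := by ring
          linarith
      _ ≤ _ := by gcongr
  have hkL : (q : ℝ) ^ (2 * d) * (k * q) ≤ q ^ (2 * d + 3) * (1 / ε) := by
    calc (q : ℝ) ^ (2 * d) * (k * q) ≤ q ^ (2 * d) * (q ^ 2 * (1 / ε) * q) := by gcongr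
      _ = _ := by ring
  have hkn : k * (d + 1) ≤ n := by
    have h1 : d + 1 ≤ q ^ (2 * d + 1) := by
      have := Nat.lt_pow_self (n := 2 * d + 1) (by omega : 1 < q)
      omega
    have h1' : (d + 1 : ℝ) ≤ q ^ (2 * d + 1) := by exact_mod_cast h1
    have : (k * (d + 1) : ℝ) ≤ n := by
      calc (k * (d + 1) : ℝ) ≤ (q ^ 2 * (1 / ε)) * q ^ (2 * d + 1) := by gcongr
        _ = q ^ (2 * d + 3) * (1 / ε) := by ring
        _ ≤ n := hn
    exact_mod_cast this
  have hn1 : 1 ≤ n := hkpos.trans_le ((Nat.le_mul_of_pos_right k (Nat.succ_pos d)).trans hkn)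
  set 𝒯 := {T ∈ erasureLists q n ℓ | (1 - α) * n ≤ (#{i | #(T i) = ℓ} : ℝ)} with h𝒯
  set B : (Fin n → Finset (ZMod q)) → Finset (Matrix (Fin N) (Fin n) (ZMod q)) := fun T =>
    {H | Fintype.card (ZMod q) ^ (2 * d) * (k * Fintype.card (ZMod q)) <
      ((LinearMap.ker H.mulVecLin : Set (Fin n → ZMod q)) ∩ {x | ∀ i, x i ∈ T i}).ncard} with hB
  have hsub : ({H | ¬ IsListRecoverableFromErasures
      (LinearMap.ker H.mulVecLin : Set (Fin n → ZMod q)) α ℓ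
          ((q : ℝ) ^ (2 * d + 3) * (1 / ε))} : Finset (Matrix (Fin N) (Fin n) (ZMod q))) ⊆
      𝒯.biUnion B := by
    intro H hH
    obtain ⟨T, hT, hG, hL⟩ :=
      exists_mem_erasureLists_of_not_isListRecoverableFromErasures hℓq (mem_filter.1 hH).2
    refine mem_biUnion.2 ⟨T, mem_filter.2 ⟨hT, hG⟩, mem_filter.2 ⟨mem_univ _, ?_⟩⟩
    rw [ZMod.card]
    exact_mod_cast hkL.trans_lt hL
  have hBT : ∀ T ∈ 𝒯, (#(B T) : ℝ) ≤
      2 * ((q : ℝ) ^ ((2 * m + 2) * n))⁻¹ * Fintype.card (Matrix (Fin N) (Fin n) (ZMod q)) := by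
    intro T hT
    obtain ⟨hT, hG⟩ := mem_filter.1 hT
    set g := #{i | #(T i) = ℓ} with hg
    have hgn : g ≤ n := (card_le_univ _).trans_eq (Fintype.card_fin n)
    set τ : ℝ := #(Fintype.piFinset T) / (q : ℝ) ^ N with hτ
    have hτ0 : 0 ≤ τ := by positivity
    have hτε : τ ≤ (q : ℝ) ^ (-(ε * n)) := by
      rw [hτ, div_le_iff₀ (by positivity), ← Real.rpow_natCast, ← Real.rpow_add hq0]
      refine (card_piFinset_le_rpow (by omega) hℓq T hT hG).trans ?_
      exact Real.rpow_le_rpow_of_exponent_le hq1.le (by linarith)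
    set δ : ℝ := 1 - m / (100 * ℓ) with hδ
    have hδ0 : 0 ≤ δ := by
      have : (m : ℝ) ≤ ℓ := by exact_mod_cast min_le_left _ _
      rw [hδ, sub_nonneg, div_le_one (by positivity)]
      have : (0 : ℝ) ≤ ℓ := by positivity
      linarith
    have hmain := card_filter_lt_ncard_ker_inter_le (ρ := Fin N) T {i | #(T i) = ℓ} (δ := δ)
      (τ := τ) hδ0 (fun i hi a b s ha hb => by
        have hi' := (mem_filter.1 hi).2
        have := ZMod.card_affine_mem_le (T i) (by omega) a b s ha hb
        rwa [hi'] at this ⊢) (by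
        rw [ZMod.card, Fintype.card_fin, hτ, div_mul_cancel₀ _ (by positivity)]) d k hkpos
    refine hmain.trans (mul_le_mul_of_nonneg_right ?_ (Nat.cast_nonneg _))
    rw [ZMod.card]
    exact pow_add_sum_le_of_decay (by omega) hm1 hε.le hkε hkn hgn hδ0 hτ0 hτε
      (pow_erasureChainLength_le (by omega) (by omega) (min_le_left _ _) hα hG)
  calc _ ≤ ((∑ T ∈ 𝒯, #(B T) : ℕ) : ℝ) :=
        Nat.cast_le.2 ((card_le_card hsub).trans card_biUnion_le)
    _ ≤ #𝒯 * (2 * ((q : ℝ) ^ ((2 * m + 2) * n))⁻¹ *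
          Fintype.card (Matrix (Fin N) (Fin n) (ZMod q))) := by
        rw [Nat.cast_sum, ← nsmul_eq_mul]
        exact sum_le_card_nsmul _ _ _ hBT
    _ ≤ (q : ℝ) ^ (2 * m * n) * ((q : ℝ) ^ n * ((q : ℝ) ^ ((2 * m + 2) * n))⁻¹ *
          Fintype.card (Matrix (Fin N) (Fin n) (ZMod q))) := by
        have h1 : (#𝒯 : ℝ) ≤ (q : ℝ) ^ (2 * m * n) := by
          exact_mod_cast (card_filter_le _ _).trans
            (card_erasureLists_le q n ℓ (by omega) hℓq)
        have h2 : (2 : ℝ) ≤ (q : ℝ) ^ n := by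
          exact_mod_cast (by omega : 2 ≤ q).trans (Nat.le_self_pow (by omega) q)
        gcongr
    _ = _ := by
        rw [← mul_assoc]
        congr 1
        rw [show (2 * m + 2) * n = 2 * m * n + n + n by ring, pow_add, pow_add]
        field_simp

theorem one_le_logb_two_natCast {q : ℕ} (hq : 2 ≤ q) : 1 ≤ Real.logb 2 q := by
  rw [Real.le_logb_iff_rpow_le one_lt_two (by exact_mod_cast (by omega : 0 < q)), Real.rpow_one]
  exact_mod_cast hq

/-- The comparison `1 / (1 - α) ≤ (1 - α) / (1 - α₀) ^ 2` moves `1 - α` to the numerator; the 5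
absorbs the ceiling, counted twice, and the 3. -/
theorem pow_erasureChainLength_le_erasureConst {q ℓ : ℕ} {α α₀ : ℝ} (hq : 2 ≤ q) (hα : α ≤ α₀)
    (hα₀ : α₀ < 1) :
    (q : ℝ) ^ (2 * erasureChainLength q ℓ α + 3) ≤
      erasureConst (1400 / (1 - α₀) ^ 2 + 5) q ℓ α := by
  have hq1 : (1 : ℝ) ≤ q := by exact_mod_cast (by omega : 1 ≤ q)
  have hlog := one_le_logb_two_natCast hq
  have h0 : 0 < 1 - α₀ := by linarith
  have h1 : 1 - α₀ ≤ 1 - α := by linarith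
  rw [erasureConst, ← Real.rpow_natCast]
  refine Real.rpow_le_rpow_of_exponent_le hq1 ?_
  have hd : (erasureChainLength q ℓ α : ℝ) < 700 * ℓ * Real.logb 2 q / (1 - α) + 1 :=
    Nat.ceil_lt_add_one (by have := h0.trans_le h1; positivity)
  have hfrac : 700 * ℓ * Real.logb 2 q / (1 - α) ≤
      700 / (1 - α₀) ^ 2 * Real.logb 2 q * ((1 - α) * ℓ) := by
    have h2 : (1 - α₀) ^ 2 ≤ (1 - α) * (1 - α) := by nlinarith
    have : 700 / (1 - α₀) ^ 2 * Real.logb 2 q * ((1 - α) * ℓ) =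
        700 * ℓ * Real.logb 2 q * (1 - α) / (1 - α₀) ^ 2 := by ring
    rw [this, div_le_div_iff₀ (by linarith) (by positivity)]
    calc 700 * ℓ * Real.logb 2 q * (1 - α₀) ^ 2
        ≤ 700 * ℓ * Real.logb 2 q * ((1 - α) * (1 - α)) := by gcongr
      _ = _ := by ring
  have hrest : 0 ≤ 1400 / (1 - α₀) ^ 2 * Real.logb 2 q := by positivity
  have hrest2 : 0 ≤ 5 * Real.logb 2 q * ((1 - α) * ℓ) := by
    have := h0.trans_le h1; positivity
  push_cast
  have e : (1400 / (1 - α₀) ^ 2 + 5) * Real.logb 2 q * ((1 - α) * ℓ + 1) =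
      2 * (700 / (1 - α₀) ^ 2 * Real.logb 2 q * ((1 - α) * ℓ)) +
      1400 / (1 - α₀) ^ 2 * Real.logb 2 q + 5 * Real.logb 2 q * ((1 - α) * ℓ) +
      5 * Real.logb 2 q := by ring
  rw [e]
  linarith

/-- Numerator minus denominator is `γ (1 - 2 γ)`. Since the base is at least 1, this exponent only
weakens the bound by `erasureConst`. -/
theorem one_le_sq_div_of_lt_one_third {γ : ℝ} (h0 : 0 < γ) (h1 : γ < 1 / 3) :
    1 ≤ (1 - γ) ^ 2 / (1 - 3 * γ * (1 - γ)) := by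
  rw [le_div_iff₀ (by nlinarith)]
  nlinarith

open Classical in
theorem toOuterMeasure_randomLinearCode_toReal (q n : ℕ) [Fact q.Prime] (R : ℝ)
    (S : Set (Submodule (ZMod q) (Fin n → ZMod q))) :
    ((randomLinearCode q n R).toOuterMeasure S).toReal = 1 -
      (Finset.card {H : Matrix (Fin ⌈(1 - R) * (n : ℝ)⌉₊) (Fin n) (ZMod q) |
        LinearMap.ker H.mulVecLin ∉ S} : ℝ) /
      Fintype.card (Matrix (Fin ⌈(1 - R) * (n : ℝ)⌉₊) (Fin n) (ZMod q)) := by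
  rw [randomLinearCode, PMF.toOuterMeasure_map_apply, PMF.toOuterMeasure_uniformOfFintype_apply,
    ENNReal.toReal_div, ENNReal.toReal_natCast, ENNReal.toReal_natCast]
  have hpos : (0 : ℝ) < Fintype.card (Matrix (Fin ⌈(1 - R) * (n : ℝ)⌉₊) (Fin n) (ZMod q)) := by
    exact_mod_cast Fintype.card_pos
  rw [eq_sub_iff_add_eq, ← add_div, div_eq_one_iff_eq hpos.ne']
  have h := Finset.card_filter_add_card_filter_not
    (s := (Finset.univ : Finset (Matrix (Fin ⌈(1 - R) * (n : ℝ)⌉₊) (Fin n) (ZMod q))))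
    fun H => LinearMap.ker H.mulVecLin ∈ S
  rw [Finset.card_univ, ← Fintype.card_subtype] at h
  rw [← h, Nat.cast_add]
  rfl

theorem mainTheorem1 :
    ∃ C : ℕ → ℕ → ℝ → ℝ,
      (∀ (q : ℕ) [Fact q.Prime] (ℓ : ℕ) (α : ℝ), 2 ≤ ℓ → ℓ ≤ q - 1 → 0 < α → α < 1 →
        0 < C q ℓ α ∧
        ∀ (n : ℕ) (ε : ℝ), 0 < ε → ε < 1 → C q ℓ α * (1 / ε) ≤ (n : ℝ) →
          1 - ((q : ℝ) ^ n)⁻¹ ≤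
            ((randomLinearCode q n (erasureRate q ℓ α ε)).toOuterMeasure
              {𝒞 | IsListRecoverableFromErasures (𝒞 : Set (Fin n → ZMod q)) α ℓ
                (C q ℓ α * (1 / ε))}).toReal) ∧
      (∀ α₀ : ℝ, α₀ < 1 → ∃ K : ℝ, 0 < K ∧
        ∀ (q : ℕ) [Fact q.Prime] (ℓ : ℕ) (α : ℝ), 2 ≤ ℓ → ℓ ≤ q - 1 → 0 < α → α ≤ α₀ →
          ((ℓ : ℝ) ≤ 2 / 3 * (q : ℝ) → C q ℓ α ≤ erasureConst K q ℓ α) ∧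
          (∀ γ : ℝ, 0 < γ → γ < 1 / 3 → (ℓ : ℝ) = (1 - γ) * (q : ℝ) →
            C q ℓ α ≤
              erasureConst K q ℓ α ^ ((1 - γ) ^ 2 / (1 - 3 * γ * (1 - γ))))) := by
  refine ⟨fun q ℓ α => (q : ℝ) ^ (2 * erasureChainLength q ℓ α + 3), ?_, fun α₀ hα₀ =>
    ⟨1400 / (1 - α₀) ^ 2 + 5, by positivity, ?_⟩⟩
  · intro q hq ℓ α hℓ hℓq hα0 hα1
    have hq2 := hq.out.two_le
    have hq0 : (0 : ℝ) < q := by exact_mod_cast (by omega : 0 < q)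
    refine ⟨by positivity, fun n ε hε hε1 hn => ?_⟩
    have hbad := card_not_isListRecoverableFromErasures_le
      (N := ⌈(1 - erasureRate q ℓ α ε) * (n : ℝ)⌉₊) hℓ (by omega) hα1 hε hε1 hn (by
        refine le_trans (le_of_eq ?_) (Nat.le_ceil _)
        rw [erasureRate]
        ring)
    rw [toOuterMeasure_randomLinearCode_toReal]
    gcongr
    rw [div_le_iff₀ (by exact_mod_cast Fintype.card_pos)]
    exact hbad
  · intro q hq ℓ α hℓ hℓq hα0 hαα₀
    have hq2 := hq.out.two_le
    have hle := pow_erasureChainLength_le_erasureConst (ℓ := ℓ) hq2 hαα₀ hα₀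
    refine ⟨fun _ => hle, fun γ hγ0 hγ1 _ => hle.trans ?_⟩
    have h1 : 1 ≤ erasureConst (1400 / (1 - α₀) ^ 2 + 5) q ℓ α :=
      le_trans (one_le_pow₀ (by exact_mod_cast (by omega : 1 ≤ q))) hle
    exact Real.self_le_rpow_of_one_le h1 (one_le_sq_div_of_lt_one_third hγ0 hγ1)
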